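/- Let $\mathcal G$ be a locally compact, not necessarily Hausdorff, étale groupoid, that is, a groupoid with a locally compact topology such that the groupoid operations are continuous, the unit space $\mathcal G^{(0)}$ is locally compact Hausdorff in the relative topology, and the range and source maps $r,s\colon\mathcal G\to\mathcal G^{(0)}$ are local homeomorphisms. An open bisection is an open set $W\subset\mathcal G$ on which $r$ and $s$ are injective. Let $C_c(\mathcal G)$ be the linear span, in the space of functions $\mathcal G\to\mathbb C$, of the extensions by zero of continuous compactly supported functions on open Hausdorff subsets of $\mathcal G$. For $x\in\mathcal G^{(0)}$ put $\mathcal G_x=s^{-1}(x)$, $\mathcal G^x=r^{-1}(x)$, $\mathcal G^x_x=\mathcal G_x\cap\mathcal G^x$, and for $f\in C_c(\mathcal G)$ let $\rho_x(f)$ be the operator on $\ell^2(\mathcal G_x)$ given by $$(\rho_x(f)\xi)(g)=\sum_{h\in\mathcal G^{r(g)}}f(h)\,\xi(h^{-1}g).$$ Let $C^*_r(\mathcal G)$ be the completion of $C_c(\mathcal G)$ with respect to the norm $\|f\|_r=\sup_{x\in\mathcal G^{(0)}}\|\rho_x(f)\|$; each $\rho_x$ extends to $C^*_r(\mathcal G)$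 by continuity. Put $$J_{\mathrm{sing}}=\{a\in C^*_r(\mathcal G)\mid \text{the set of } x\in\mathcal G^{(0)} \text{ such that } \rho_x(a)\delta_x\neq0 \text{ is meager in } \mathcal G^{(0)}\}.$$ Assume that $\mathcal G$ can be covered by countably many open bisections. Let $D_0\subset\mathcal G^{(0)}$ be the set of points $x\in\mathcal G^{(0)}$ for which there exist finitely many elements $g_1,\dots,g_n\in\mathcal G^x_x\setminus\{x\}$, open bisections $U_1,\dots,U_n$ with $g_k\in U_k$ for all $k$, and an open neighbourhood $U$ of $x$ in $\mathcal G^{(0)}$ such that $U\setminus(U_1\cup\dots\cup U_n)$ has empty interior. Then, for every dense subset $Y$ of $\mathcal G^{(0)}\setminus D_0$, $$J_{\mathrm{sing}}=\{a\in C^*_r(\mathcal G)\mid \text{the set of } x\in\mathcal G^{(0)} \text{ such that } \rho_x(a)\neq0 \text{ is meager in } \mathcal G^{(0)}\}=\bigcap_{y\in Y}\ker\rho_y .$$ In particular, if $D_0=\emptyset$, then $J_{\mathrm{sing}}=0$. -/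

import Mathlib

/-- A groupoid, presented by its set `G` of arrows. Units are identified with identity arrows, so
the source and range maps are maps `G → G`. The product `mul g h` is meaningful only if
`src g = rng h`; its values on other pairs are irrelevant, no law or definition uses them. -/
class ArrowGroupoid (G : Type*) where
  src : G → G
  rng : G → G
  mul : G → G → G
  inv : G → G
  rng_src : ∀ g, rng (src g) = src g
  src_rng : ∀ g, src (rng g) = rng g
  src_mul : ∀ g h, src g = rng h → src (mul g h) = src h
  rng_mul : ∀ g h, src g = rng h → rng (mul g h) = rng g
  assoc : ∀ g h k, src g = rng h → src h = rng k → mul (mul g h) k = mul g (mul h k)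
  mul_src : ∀ g, mul g (src g) = g
  rng_mul_self : ∀ g, mul (rng g) g = g
  src_inv : ∀ g, src (inv g) = rng g
  rng_inv : ∀ g, rng (inv g) = src g
  inv_mul_self : ∀ g, mul (inv g) g = src g
  mul_inv_self : ∀ g, mul g (inv g) = rng g

namespace ArrowGroupoid

/-- The unit space `𝒢⁽⁰⁾`, a subset of `𝒢`; as a type it carries the relative topology. -/
def unitSpace (G : Type*) [ArrowGroupoid G] : Set G := {x | src x = x}

section algebra

variable {G : Type*} [ArrowGroupoid G]

theorem src_src (g : G) : src (src g) = src g := by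
  have h := src_rng (src g)
  rwa [rng_src] at h

/-- The source map `s : 𝒢 → 𝒢⁽⁰⁾`. -/
def srcMap (g : G) : unitSpace G := ⟨src g, src_src g⟩

/-- The range map `r : 𝒢 → 𝒢⁽⁰⁾`. -/
def rngMap (g : G) : unitSpace G := ⟨rng g, src_rng g⟩

/-- The source fibre `𝒢ₓ = s⁻¹(x)`. -/
abbrev SrcFiber (x : unitSpace G) : Type _ := {g : G // src g = x.1}

/-- The range fibre `𝒢ᵘ = r⁻¹(u)`. -/
abbrev RngFiber (u : G) : Type _ := {h : G // rng h = u}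

/-- The unit `x` as an element of `𝒢ₓ`. -/
def unitPt (x : unitSpace G) : SrcFiber x := ⟨x.1, x.2⟩

/-- For `g ∈ 𝒢ₓ` and `h ∈ 𝒢^{r(g)}`, the element `h⁻¹g ∈ 𝒢ₓ`. -/
def leftDiv {x : unitSpace G} (g : SrcFiber x) (h : RngFiber (rng g.1)) : SrcFiber x :=
  ⟨mul (inv h.1) g.1, by rw [src_mul _ _ (by rw [src_inv, h.2]), g.2]⟩

/-- The function `g ↦ ∑_{h ∈ 𝒢^{r(g)}} f(h) ξ(h⁻¹g)` on `𝒢ₓ`. -/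
noncomputable def convVec (f : G → ℂ) {x : unitSpace G} (ξ : SrcFiber x → ℂ) : SrcFiber x → ℂ :=
  fun g => ∑' h : RngFiber (rng g.1), f h.1 * ξ (leftDiv g h)

/-- The Hilbert space `ℓ²(𝒢ₓ)`. -/
abbrev L2Fiber (x : unitSpace G) : Type _ := lp (fun _ : SrcFiber x => ℂ) 2

/-- The basis vector `δ_g ∈ ℓ²(𝒢ₓ)`. -/
noncomputable def delta {x : unitSpace G} (g : SrcFiber x) : L2Fiber x := by
  classical exact lp.single 2 g (1 : ℂ)

/-! Boundedness of the operators `ξ ↦ convVec f ξ` for `f ∈ C_c(𝒢)`, uniformly in the unit. -/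

/-- Auxiliary: `f` has finite support on range fibres and acts boundedly, with a bound that does
not depend on the unit. -/
def Nice (f : G → ℂ) : Prop :=
  (∀ u, (Function.support fun h : RngFiber u => f h.1).Finite) ∧
  ∃ C : ℝ, 0 ≤ C ∧ ∀ (x : unitSpace G) (ξ : L2Fiber x),
    ∃ η : L2Fiber x, (η : SrcFiber x → ℂ) = convVec f ξ ∧ ‖η‖ ≤ C * ‖ξ‖

theorem Nice.summable {f : G → ℂ} (hf : Nice f) {x : unitSpace G} (ξ : SrcFiber x → ℂ)
    (g : SrcFiber x) :
    Summable fun h : RngFiber (rng g.1) => f h.1 * ξ (leftDiv g h) :=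
  summable_of_hasFiniteSupport <| (hf.1 _).subset fun h hh => by
    simp only [Function.mem_support] at hh ⊢
    exact left_ne_zero_of_mul hh

theorem Nice.convVec_add {f f' : G → ℂ} (hf : Nice f) (hf' : Nice f') {x : unitSpace G}
    (ξ : SrcFiber x → ℂ) : convVec (f + f') ξ = convVec f ξ + convVec f' ξ := by
  funext g
  simp only [convVec, Pi.add_apply, add_mul]
  exact (hf.summable ξ g).tsum_add (hf'.summable ξ g)

theorem convVec_smul (c : ℂ) (f : G → ℂ) {x : unitSpace G}
    (ξ : SrcFiber x → ℂ) : convVec (c • f) ξ = c • convVec f ξ := by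
  funext g
  simp only [convVec, Pi.smul_apply, smul_eq_mul, mul_assoc]
  exact tsum_mul_left

theorem Nice.convVec_add_right {f : G → ℂ} (hf : Nice f) {x : unitSpace G}
    (ξ η : SrcFiber x → ℂ) : convVec f (ξ + η) = convVec f ξ + convVec f η := by
  funext g
  simp only [convVec, Pi.add_apply, mul_add]
  exact (hf.summable ξ g).tsum_add (hf.summable η g)

theorem convVec_smul_right (f : G → ℂ) (c : ℂ) {x : unitSpace G}
    (ξ : SrcFiber x → ℂ) : convVec f (c • ξ) = c • convVec f ξ := by
  funext g
  simp only [convVec, Pi.smul_apply, smul_eq_mul, mul_left_comm _ c]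
  exact tsum_mul_left

theorem Nice.zero : Nice (0 : G → ℂ) := by
  refine ⟨fun u => by simp, 0, le_rfl, fun x ξ => ⟨0, ?_, by simp⟩⟩
  funext g
  simp [convVec]

theorem Nice.add {f f' : G → ℂ} (hf : Nice f) (hf' : Nice f') : Nice (f + f') := by
  obtain ⟨C, hC, H⟩ := hf.2
  obtain ⟨C', hC', H'⟩ := hf'.2
  refine ⟨fun u => ((hf.1 u).union (hf'.1 u)).subset ?_, C + C', by positivity, fun x ξ => ?_⟩
  · exact Function.support_add (fun h : RngFiber u => f h.1) (fun h : RngFiber u => f' h.1)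
  · obtain ⟨η, h1, h2⟩ := H x ξ
    obtain ⟨η', h1', h2'⟩ := H' x ξ
    refine ⟨η + η', ?_, ?_⟩
    · rw [hf.convVec_add hf', ← h1, ← h1']; rfl
    · calc ‖η + η'‖ ≤ ‖η‖ + ‖η'‖ := norm_add_le _ _
        _ ≤ (C + C') * ‖ξ‖ := by linarith

theorem Nice.smul {f : G → ℂ} (hf : Nice f) (c : ℂ) : Nice (c • f) := by
  obtain ⟨C, hC, H⟩ := hf.2
  refine ⟨fun u => (hf.1 u).subset fun h hh => ?_, ‖c‖ * C, by positivity, fun x ξ => ?_⟩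
  · simp only [Function.mem_support, Pi.smul_apply, smul_eq_mul] at hh ⊢
    exact right_ne_zero_of_mul hh
  · obtain ⟨η, h1, h2⟩ := H x ξ
    refine ⟨c • η, ?_, ?_⟩
    · rw [convVec_smul, ← h1]; rfl
    · rw [norm_smul, mul_assoc]
      gcongr

theorem mul_leftDiv {x : unitSpace G} (g : SrcFiber x) (h : RngFiber (rng g.1)) :
    mul h.1 (leftDiv g h).1 = g.1 := by
  have h1 : src h.1 = rng (inv h.1) := (rng_inv _).symm
  have h2 : src (inv h.1) = rng g.1 := by rw [src_inv, h.2]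
  rw [leftDiv, ← assoc _ _ _ h1 h2, mul_inv_self, h.2, rng_mul_self]

theorem rng_leftDiv {x : unitSpace G} (g : SrcFiber x) (h : RngFiber (rng g.1)) :
    rng (leftDiv g h).1 = src h.1 := by
  rw [leftDiv, rng_mul _ _ (by rw [src_inv, h.2]), rng_inv]

theorem nice_of_bisection {f : G → ℂ} {A : Set G} (hs : Set.InjOn src A) (hr : Set.InjOn rng A)
    {M : ℝ} (hM : ∀ g, ‖f g‖ ≤ M) (hA : ∀ g, g ∉ A → f g = 0) : Nice f := by
  classical
  have hsub : ∀ u (h h' : RngFiber u), h.1 ∈ A → h'.1 ∈ A → h = h' := fun u h h' m m' =>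
    Subtype.ext (hr m m' (h.2.trans h'.2.symm))
  rcases isEmpty_or_nonempty G with hG | ⟨⟨g₀⟩⟩
  · refine ⟨fun u => (hG.false u).elim, 0, le_rfl, fun x => (hG.false x.1).elim⟩
  have hM0 : 0 ≤ M := (norm_nonneg _).trans (hM g₀)
  refine ⟨fun u => ?_, M, hM0, fun x ξ => ?_⟩
  · refine Set.Subsingleton.finite fun h hh h' hh' => hsub u h h' ?_ ?_
    · by_contra hc; exact hh (hA _ hc)
    · by_contra hc; exact hh' (hA _ hc)
  · have hp : (0 : ℝ) < (2 : ENNReal).toReal := by norm_num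
    have key : ∀ s : Finset (SrcFiber x),
        ∑ g ∈ s, ‖convVec f ξ g‖ ^ (2 : ENNReal).toReal
          ≤ (M * ‖ξ‖) ^ (2 : ENNReal).toReal := by
      intro s
      let P : SrcFiber x → Prop := fun g => ∃ h : RngFiber (rng g.1), h.1 ∈ A
      let e : SrcFiber x → SrcFiber x := fun g => if hg : P g then leftDiv g hg.choose else g
      have he : ∀ g (hg : P g), e g = leftDiv g hg.choose := fun g hg => dif_pos hg
      have hval : ∀ g, P g → ‖convVec f ξ g‖ ≤ M * ‖ξ (e g)‖ := by
        intro g hg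
        have : convVec f ξ g = f hg.choose.1 * ξ (leftDiv g hg.choose) := by
          refine tsum_eq_single hg.choose fun h hne => ?_
          rw [hA h.1 fun hm => hne (hsub _ _ _ hm hg.choose_spec), zero_mul]
        rw [this, he g hg, norm_mul]
        gcongr
        exact hM _
      have hval0 : ∀ g, ¬ P g → convVec f ξ g = 0 := by
        intro g hg
        have : ∀ h : RngFiber (rng g.1), f h.1 * ξ (leftDiv g h) = 0 := fun h => by
          rw [hA h.1 fun hm => hg ⟨h, hm⟩, zero_mul]
        simp only [convVec, this, tsum_zero]
      have hinj : Set.InjOn e (s.filter P : Finset (SrcFiber x)) := by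
        intro g hg g' hg' hee
        have hgP : P g := (Finset.mem_filter.1 hg).2
        have hgP' : P g' := (Finset.mem_filter.1 hg').2
        rw [he g hgP, he g' hgP'] at hee
        have hh : hgP.choose.1 = hgP'.choose.1 := by
          refine hs hgP.choose_spec hgP'.choose_spec ?_
          rw [← rng_leftDiv g, ← rng_leftDiv g', hee]
        apply Subtype.ext
        rw [← mul_leftDiv g hgP.choose, ← mul_leftDiv g' hgP'.choose, hee, hh]
      calc ∑ g ∈ s, ‖convVec f ξ g‖ ^ (2 : ENNReal).toReal
          = ∑ g ∈ s.filter P, ‖convVec f ξ g‖ ^ (2 : ENNReal).toReal := by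
            refine (Finset.sum_filter_of_ne fun g _ hne => ?_).symm
            by_contra hc
            exact hne (by rw [hval0 g hc, norm_zero, Real.zero_rpow hp.ne'])
        _ ≤ ∑ g ∈ s.filter P, (M * ‖ξ (e g)‖) ^ (2 : ENNReal).toReal := by
            refine Finset.sum_le_sum fun g hg => ?_
            exact Real.rpow_le_rpow (norm_nonneg _) (hval g (Finset.mem_filter.1 hg).2) hp.le
        _ = M ^ (2 : ENNReal).toReal *
              ∑ g ∈ s.filter P, ‖ξ (e g)‖ ^ (2 : ENNReal).toReal := by
            rw [Finset.mul_sum]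
            refine Finset.sum_congr rfl fun g _ => ?_
            rw [Real.mul_rpow hM0 (norm_nonneg _)]
        _ = M ^ (2 : ENNReal).toReal *
              ∑ k ∈ (s.filter P).image e, ‖ξ k‖ ^ (2 : ENNReal).toReal := by
            rw [Finset.sum_image hinj]
        _ ≤ M ^ (2 : ENNReal).toReal * ‖ξ‖ ^ (2 : ENNReal).toReal := by
            gcongr
            exact lp.sum_rpow_le_norm_rpow hp ξ _
        _ = (M * ‖ξ‖) ^ (2 : ENNReal).toReal := by
            rw [Real.mul_rpow hM0 (norm_nonneg _)]
    exact ⟨⟨convVec f ξ, memℓp_gen' key⟩, rfl,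
      lp.norm_le_of_forall_sum_le hp (by positivity) key⟩

end algebra

/-- A locally compact, not necessarily Hausdorff, étale groupoid. -/
class IsEtale (G : Type*) [TopologicalSpace G] [ArrowGroupoid G] : Prop where
  locallyCompact : LocallyCompactSpace G
  continuousOn_mul : ContinuousOn (fun p : G × G => mul p.1 p.2) {p | src p.1 = rng p.2}
  continuous_inv : Continuous (inv : G → G)
  t2_unitSpace : T2Space (unitSpace G)
  locallyCompact_unitSpace : LocallyCompactSpace (unitSpace G)
  isLocalHomeomorph_src : IsLocalHomeomorph (srcMap : G → unitSpace G)
  isLocalHomeomorph_rng : IsLocalHomeomorph (rngMap : G → unitSpace G)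

section topology

variable {G : Type*} [TopologicalSpace G] [ArrowGroupoid G]

/-- An open bisection: an open set on which the source and range maps are injective. -/
def IsOpenBisection (U : Set G) : Prop :=
  IsOpen U ∧ Set.InjOn src U ∧ Set.InjOn rng U

variable (G) in
/-- The space `C_c(𝒢)`: the span of the extensions by zero of continuous compactly supported
functions on open Hausdorff subsets `V` of `𝒢`. -/
def Cc : Submodule ℂ (G → ℂ) :=
  Submodule.span ℂ {f | ∃ V : Set G, IsOpen V ∧ T2Space V ∧
    ∃ φ : CompactlySupportedContinuousMap V ℂ, f = Function.extend Subtype.val φ 0}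

theorem nice_of_finite_cover {ι : Type*} (W : ι → Set G) (hW : ∀ i, IsOpenBisection (W i))
    (t : Finset ι) : ∀ (f : G → ℂ) (M : ℝ), (∀ g, ‖f g‖ ≤ M) →
      (∀ g, g ∉ ⋃ i ∈ t, W i → f g = 0) → Nice f := by
  classical
  induction t using Finset.induction_on with
  | empty =>
    intro f M _ h0
    have : f = 0 := funext fun g => h0 g (by simp)
    rw [this]
    exact Nice.zero
  | insert a t _ ih =>
    intro f M hM h0
    have hM' : ∀ (S : Set G) g, ‖S.indicator f g‖ ≤ M := fun S g =>
      (norm_indicator_le_norm_self f g).trans (hM g)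
    have h1 : Nice ((W a).indicator f) :=
      nice_of_bisection (hW a).2.1 (hW a).2.2 (hM' _) fun g hg => Set.indicator_of_notMem hg f
    have h2 : Nice ((W a)ᶜ.indicator f) := by
      refine ih _ M (hM' _) fun g hg => ?_
      by_cases hga : g ∈ W a
      · exact Set.indicator_of_notMem (fun h => absurd hga h) f
      · rw [Set.indicator_of_mem (show g ∈ (W a)ᶜ from hga)]
        refine h0 g ?_
        simp only [Finset.set_biUnion_insert, Set.mem_union, not_or]
        exact ⟨hga, hg⟩
    rw [← Set.indicator_self_add_compl (W a) f]
    exact h1.add h2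

theorem exists_openBisection [IsEtale G] (g : G) : ∃ U : Set G, IsOpenBisection U ∧ g ∈ U := by
  obtain ⟨e, he, hes⟩ := (IsEtale.isLocalHomeomorph_src (G := G)) g
  obtain ⟨e', he', hes'⟩ := (IsEtale.isLocalHomeomorph_rng (G := G)) g
  refine ⟨e.source ∩ e'.source, ⟨e.open_source.inter e'.open_source, ?_, ?_⟩, he, he'⟩
  · intro a ha b hb hab
    refine e.injOn ha.1 hb.1 ?_
    rw [← hes]
    exact Subtype.ext hab
  · intro a ha b hb hab
    refine e'.injOn ha.2 hb.2 ?_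
    rw [← hes']
    exact Subtype.ext hab

theorem nice_of_mem_Cc [IsEtale G] {f : G → ℂ} (hf : f ∈ Cc G) : Nice f := by
  classical
  induction hf using Submodule.span_induction with
  | zero => exact Nice.zero
  | add f f' _ _ h h' => exact h.add h'
  | smul c f _ h => exact h.smul c
  | mem f hf =>
    obtain ⟨V, _, _, φ, rfl⟩ := hf
    choose W hW hgW using fun g : G => exists_openBisection g
    have hK : IsCompact ((Subtype.val : V → G) '' tsupport φ) :=
      IsCompact.image φ.hasCompactSupport continuous_subtype_val
    obtain ⟨t, ht⟩ := hK.elim_finite_subcover W (fun i => (hW i).1)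
      fun g _ => Set.mem_iUnion.2 ⟨g, hgW g⟩
    obtain ⟨M, hM⟩ := φ.hasCompactSupport.exists_bound_of_continuous φ.continuous
    refine nice_of_finite_cover W hW t _ (max M 0) (fun g => ?_) fun g hg => ?_
    · by_cases hgV : g ∈ V
      · have := Subtype.val_injective.extend_apply φ 0 (⟨g, hgV⟩ : V)
        simp only at this
        rw [this]
        exact (hM _).trans (le_max_left _ _)
      · rw [Function.extend_apply' _ _ _ (by rintro ⟨v, rfl⟩; exact hgV v.2)]
        simp
    · by_cases hgV : g ∈ V
      · have := Subtype.val_injective.extend_apply φ 0 (⟨g, hgV⟩ : V)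
        simp only at this
        rw [this]
        by_contra hne
        exact hg (ht ⟨⟨g, hgV⟩, subset_tsupport _ hne, rfl⟩)
      · rw [Function.extend_apply' _ _ _ (by rintro ⟨v, rfl⟩; exact hgV v.2)]
        simp

/-! The representations `ρₓ` and the reduced norm. -/

variable (G) in
/-- A copy of `C_c(𝒢)`, to be equipped with the reduced norm (and not with the topology of
pointwise convergence). -/
def CcRed : Type _ := Cc G

noncomputable instance : AddCommGroup (CcRed G) := inferInstanceAs (AddCommGroup (Cc G))

noncomputable instance : Module ℂ (CcRed G) := inferInstanceAs (Module ℂ (Cc G))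

/-- The function on `𝒢` underlying an element of `C_c(𝒢)`. -/
def CcRed.toFun (f : CcRed G) : G → ℂ := Subtype.val (p := fun f => f ∈ Cc G) f

variable [IsEtale G]

theorem CcRed.nice (f : CcRed G) : Nice f.toFun :=
  nice_of_mem_Cc (Subtype.prop (p := fun f => f ∈ Cc G) f)

theorem CcRed.memLp (f : CcRed G) (x : unitSpace G) (ξ : L2Fiber x) :
    Memℓp (convVec f.toFun ξ) 2 := by
  obtain ⟨C, _, H⟩ := f.nice.2
  obtain ⟨η, h1, _⟩ := H x ξ
  rw [← h1]
  exact lp.memℓp η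

theorem CcRed.exists_bound (f : CcRed G) : ∃ C : ℝ, 0 ≤ C ∧ ∀ (x : unitSpace G) (ξ : L2Fiber x),
    ‖(⟨convVec f.toFun ξ, f.memLp x ξ⟩ : L2Fiber x)‖ ≤ C * ‖ξ‖ := by
  obtain ⟨C, hC, H⟩ := f.nice.2
  refine ⟨C, hC, fun x ξ => ?_⟩
  obtain ⟨η, h1, h2⟩ := H x ξ
  have : (⟨convVec f.toFun ξ, f.memLp x ξ⟩ : L2Fiber x) = η := Subtype.ext h1.symm
  rwa [this]

/-- The operator `ρₓ(f)` on `ℓ²(𝒢ₓ)`, for `f ∈ C_c(𝒢)`: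
`(ρₓ(f)ξ)(g) = ∑_{h ∈ 𝒢^{r(g)}} f(h) ξ(h⁻¹g)`. -/
noncomputable def rhoOp (x : unitSpace G) (f : CcRed G) : L2Fiber x →L[ℂ] L2Fiber x :=
  LinearMap.mkContinuousOfExistsBound
    { toFun := fun ξ => ⟨convVec f.toFun ξ, f.memLp x ξ⟩
      map_add' := fun ξ η => Subtype.ext (f.nice.convVec_add_right ξ η)
      map_smul' := fun c ξ => Subtype.ext (convVec_smul_right f.toFun c ξ) }
    (f.exists_bound.imp fun _ hC => hC.2 x)

theorem rhoOp_apply (x : unitSpace G) (f : CcRed G) (ξ : L2Fiber x) (g : SrcFiber x) :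
    rhoOp x f ξ g = ∑' h : RngFiber (rng g.1), f.toFun h.1 * ξ (leftDiv g h) := rfl

/-- `f ↦ ρₓ(f)` as a linear map. -/
noncomputable def rhoLin (x : unitSpace G) : CcRed G →ₗ[ℂ] (L2Fiber x →L[ℂ] L2Fiber x) where
  toFun := rhoOp x
  map_add' f f' := ContinuousLinearMap.ext fun ξ =>
    Subtype.ext (f.nice.convVec_add f'.nice ξ)
  map_smul' c f := ContinuousLinearMap.ext fun ξ => Subtype.ext (convVec_smul c f.toFun ξ)

theorem bddAbove_rho (f : CcRed G) :
    BddAbove (Set.range fun x : unitSpace G => ‖rhoLin x f‖) := by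
  obtain ⟨C, hC, H⟩ := f.exists_bound
  refine ⟨C, ?_⟩
  rintro _ ⟨x, rfl⟩
  exact ContinuousLinearMap.opNorm_le_bound _ hC (H x)

/-- The reduced norm `‖f‖ᵣ = sup_{x ∈ 𝒢⁽⁰⁾} ‖ρₓ(f)‖`. -/
noncomputable instance : Norm (CcRed G) := ⟨fun f => ⨆ x : unitSpace G, ‖rhoLin x f‖⟩

theorem norm_rhoLin_le (x : unitSpace G) (f : CcRed G) : ‖rhoLin x f‖ ≤ ‖f‖ :=
  le_ciSup (bddAbove_rho f) x

theorem redNorm_core : SeminormedSpace.Core ℂ (CcRed G) where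
  norm_nonneg f := Real.iSup_nonneg fun x => norm_nonneg _
  norm_smul c f := by
    change (⨆ x : unitSpace G, ‖rhoLin x (c • f)‖) = ‖c‖ * ⨆ x : unitSpace G, ‖rhoLin x f‖
    rw [Real.mul_iSup_of_nonneg (norm_nonneg c)]
    exact iSup_congr fun x => by rw [map_smul, norm_smul]
  norm_triangle f f' := by
    refine Real.iSup_le (fun x => ?_) (add_nonneg (Real.iSup_nonneg fun x => norm_nonneg _)
      (Real.iSup_nonneg fun x => norm_nonneg _))
    rw [map_add]
    exact (norm_add_le _ _).trans (add_le_add (norm_rhoLin_le x f) (norm_rhoLin_le x f'))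

noncomputable instance : SeminormedAddCommGroup (CcRed G) :=
  SeminormedAddCommGroup.ofCore redNorm_core

noncomputable instance : NormedSpace ℂ (CcRed G) where
  norm_smul_le c f := (redNorm_core.norm_smul c f).le

variable (G) in
/-- (The Banach space underlying) the reduced C*-algebra `C*ᵣ(𝒢)`: the completion of `C_c(𝒢)` with
respect to the reduced norm. -/
abbrev CStarRed : Type _ := UniformSpace.Completion (CcRed G)

/-- `ρₓ` on `C_c(𝒢)` as a bounded map for the reduced norm. -/
noncomputable def rhoCc (x : unitSpace G) : CcRed G →L[ℂ] (L2Fiber x →L[ℂ] L2Fiber x) :=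
  (rhoLin x).mkContinuous 1 fun f => by rw [one_mul]; exact norm_rhoLin_le x f

/-- The representation `ρₓ` of `C*ᵣ(𝒢)`: the continuous extension of `ρₓ` from `C_c(𝒢)`. -/
noncomputable def rho (x : unitSpace G) : CStarRed G →L[ℂ] (L2Fiber x →L[ℂ] L2Fiber x) :=
  (rhoCc x).extend UniformSpace.Completion.toComplL

/-- `rho x` does extend the map given by the defining formula on `C_c(𝒢)`. -/
theorem rho_coe (x : unitSpace G) (f : CcRed G) : rho x (f : CStarRed G) = rhoOp x f :=
  ContinuousLinearMap.extend_eq (rhoCc x) (e := UniformSpace.Completion.toComplL)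
    UniformSpace.Completion.denseRange_coe
    (UniformSpace.Completion.isUniformInducing_coe _) f

variable (G) in
/-- The singular ideal: all `a` such that `ρₓ(a)δₓ ≠ 0` only for a meager set of units `x`. -/
def singularIdeal : Set (CStarRed G) :=
  {a | IsMeagre {x : unitSpace G | rho x a (delta (unitPt x)) ≠ 0}}

end topology

/-- The set `D₀` of units `x` for which there are finitely many elements `g₁, …, gₙ ≠ x` of the
isotropy group at `x`, open bisections `Wₖ ∋ gₖ` and an open neighbourhood `U` of `x` in `𝒢⁽⁰⁾`
such that `U \ (W₁ ∪ … ∪ Wₙ)` has empty interior. -/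
def extremelyDangerous (G : Type*) [TopologicalSpace G] [ArrowGroupoid G] : Set (unitSpace G) :=
  {x | ∃ (n : ℕ) (g : Fin n → G) (W : Fin n → Set G) (U : Set (unitSpace G)),
    (∀ k, src (g k) = x.1 ∧ rng (g k) = x.1 ∧ g k ≠ x.1) ∧
    (∀ k, IsOpenBisection (W k) ∧ g k ∈ W k) ∧
    IsOpen U ∧ x ∈ U ∧ interior (U \ ⋃ k, Subtype.val ⁻¹' W k) = ∅}

end ArrowGroupoid

/-! Matrix entries of `rho x f` are values f(gh⁻¹), so by density every a in the completion has
entries depending only on the arrow gh⁻¹. The entries in any column of `rho x a` then reappear in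
the δ-columns at the units r(h), h ∈ 𝒢ₓ. Countably many bisections carry meager sets of ranges to
meager sets of sources, which gives the first equality.

For the second, the obstacle is that f ∈ C_c(𝒢) need not be continuous. By
`exists_bisections_tendsto`, f is continuous along a local section σ as long as σ avoids finitely
many bisections through arrows parallel to σ(x₀). There are two ways to avoid them. Off the meager
set `intersectionBoundary W`, which contains D₀, a section of s avoids them near the base point, so
`rho x a δₓ ≠ 0` spreads to a neighbourhood (`eventually_rho_ne_zero`) and is detected by a dense Y.
At y ∉ D₀, translation turns them into bisections through nontrivial isotropy at y, and the
definition of D₀ leaves an open set of units where they are avoided (`exists_isOpen_rho_ne_zero`);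
the Baire theorem then excludes meager support. -/

open Filter Topology

namespace ArrowGroupoid

/-! ### Groupoid identities and matrix entries -/

section algebra

variable {G : Type*} [ArrowGroupoid G]

theorem rng_eq_self_of_src_eq_self {x : G} (hx : src x = x) : rng x = x := by
  have h := rng_src x
  rwa [hx] at h

theorem rngMap_unit (x : unitSpace G) : rngMap x.1 = x :=
  Subtype.ext (rng_eq_self_of_src_eq_self x.2)

theorem inv_eq_self_of_src_eq_self {x : G} (hx : src x = x) : inv x = x := by
  have hr := rng_eq_self_of_src_eq_self hx
  have h1 := mul_src (inv x)
  rw [src_inv, hr, inv_mul_self, hx] at h1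
  exact h1.symm

theorem src_mul_inv {g h : G} (e : src g = src h) : src (mul g (inv h)) = rng h := by
  rw [src_mul _ _ (by rw [rng_inv, e]), src_inv]

theorem rng_mul_inv {g h : G} (e : src g = src h) : rng (mul g (inv h)) = rng g :=
  rng_mul _ _ (by rw [rng_inv, e])

theorem mul_inv_mul_cancel {g h : G} (e : src g = src h) : mul (mul g (inv h)) h = g := by
  rw [assoc _ _ _ (by rw [rng_inv, e]) (src_inv h), inv_mul_self, ← e, mul_src]

theorem mul_mul_inv_cancel {g h : G} (e : src g = rng h) : mul (mul g h) (inv h) = g := by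
  rw [assoc _ _ _ e (rng_inv h).symm, mul_inv_self, ← e, mul_src]

theorem inv_mul_mul_cancel {g h : G} (e : src g = rng h) : mul (inv g) (mul g h) = h := by
  rw [← assoc _ _ _ (src_inv g) e, inv_mul_self, e, rng_mul_self]

theorem mul_inv_mul_mul_cancel {g h : G} (e : rng g = rng h) : mul g (mul (inv g) h) = h := by
  rw [← assoc _ _ _ (rng_inv g).symm (by rw [src_inv, e]), mul_inv_self, e, rng_mul_self]

theorem mul_left_cancel_of_src {g h k : G} (e₁ : src g = rng h) (e₂ : src g = rng k)
    (e : mul g h = mul g k) : h = k := by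
  rw [← inv_mul_mul_cancel e₁, e, inv_mul_mul_cancel e₂]

theorem mul_right_cancel_of_rng {g h k : G} (e₁ : src g = rng k) (e₂ : src h = rng k)
    (e : mul g k = mul h k) : g = h := by
  rw [← mul_mul_inv_cancel e₁, e, mul_mul_inv_cancel e₂]

theorem src_inv_mul {g h : G} (e : rng g = rng h) : src (mul (inv g) h) = src h :=
  src_mul _ _ (by rw [src_inv, e])

theorem rng_inv_mul {g h : G} (e : rng g = rng h) : rng (mul (inv g) h) = src g := by
  rw [rng_mul _ _ (by rw [src_inv, e]), rng_inv]

theorem leftDiv_eq_iff {x : unitSpace G} (g h : SrcFiber x) (k : RngFiber (rng g.1)) :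
    leftDiv g k = h ↔ k.1 = mul g.1 (inv h.1) := by
  have hgh : src g.1 = src h.1 := g.2.trans h.2.symm
  constructor
  · intro e
    have hk : src k.1 = rng h.1 := by rw [← e, rng_leftDiv]
    have hm := mul_leftDiv g k
    rw [e] at hm
    calc k.1 = mul (mul k.1 h.1) (inv h.1) := (mul_mul_inv_cancel hk).symm
      _ = mul g.1 (inv h.1) := by rw [hm]
  · intro e
    have hk : src k.1 = rng h.1 := by rw [e, src_mul_inv hgh]
    refine Subtype.ext (mul_left_cancel_of_src (g := k.1) (rng_leftDiv g k).symm hk ?_)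
    rw [mul_leftDiv, e, mul_inv_mul_cancel hgh]

theorem delta_apply {x : unitSpace G} (h k : SrcFiber x) [Decidable (k = h)] :
    delta h k = if k = h then 1 else 0 := by
  classical
  split_ifs with e
  · subst e
    exact lp.single_apply_self (E := fun _ : SrcFiber x => ℂ) 2 k (1 : ℂ)
  · exact lp.single_apply_ne (E := fun _ : SrcFiber x => ℂ) 2 h (1 : ℂ) e

theorem norm_delta {x : unitSpace G} (h : SrcFiber x) : ‖delta h‖ = 1 := by
  classical
  exact (lp.norm_single (E := fun _ : SrcFiber x => ℂ) (by norm_num) h (1 : ℂ)).trans (by simp)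

/-- Only the summand with k⁻¹g = h survives, that is k = gh⁻¹. -/
theorem convVec_delta (f : G → ℂ) {x : unitSpace G} (g h : SrcFiber x) :
    convVec f (delta h) g = f (mul g.1 (inv h.1)) := by
  classical
  have hgh : src g.1 = src h.1 := g.2.trans h.2.symm
  refine (tsum_eq_single (⟨mul g.1 (inv h.1), rng_mul_inv hgh⟩ : RngFiber (rng g.1))
    fun k hk => ?_).trans ?_
  · rw [delta_apply, if_neg, mul_zero]
    rw [leftDiv_eq_iff]
    exact fun e => hk (Subtype.ext e)
  · rw [delta_apply, if_pos ((leftDiv_eq_iff _ _ _).2 rfl), mul_one]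

theorem ext_delta {x : unitSpace G} {T : L2Fiber x →L[ℂ] L2Fiber x}
    (hT : ∀ h g, T (delta h) g = 0) : T = 0 := by
  classical
  ext1 ξ
  have h1 := (lp.hasSum_single (E := fun _ : SrcFiber x => ℂ) (by norm_num) ξ).mapL T
  have h2 : ∀ h : SrcFiber x, T (lp.single 2 h (ξ h)) = 0 := by
    intro h
    have e1 : (lp.single 2 h (ξ h) : L2Fiber x) = ξ h • delta h := by
      refine lp.ext (funext fun k => ?_)
      rw [lp.coeFn_smul, Pi.smul_apply, delta_apply]
      split_ifs with e
      · subst e; simp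
      · rw [lp.single_apply_ne _ _ _ e]; simp
    have e2 : T (delta h) = 0 := lp.ext (funext fun g => hT h g)
    rw [e1, map_smul, e2, smul_zero]
  simp only [h2] at h1
  exact h1.unique hasSum_zero

end algebra

/-! ### Matrix coefficients on the completion -/

section coefficients

variable {G : Type*} [TopologicalSpace G] [ArrowGroupoid G] [IsEtale G]

/-- The matrix coefficient `a ↦ ⟨ρₓ(a) δ_h, δ_g⟩` on `C*ᵣ(𝒢)`. -/
noncomputable def coeff {x : unitSpace G} (g h : SrcFiber x) (a : CStarRed G) : ℂ :=
  rho x a (delta h) g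

theorem coeff_sub {x : unitSpace G} (g h : SrcFiber x) (a b : CStarRed G) :
    coeff g h (a - b) = coeff g h a - coeff g h b := by
  simp [coeff, map_sub]

theorem norm_rho_le (x : unitSpace G) (a : CStarRed G) : ‖rho x a‖ ≤ ‖a‖ := by
  induction a using UniformSpace.Completion.induction_on with
  | hp => exact isClosed_le (rho x).continuous.norm continuous_norm
  | ih f =>
    rw [rho_coe, UniformSpace.Completion.norm_coe]
    exact norm_rhoLin_le x f

theorem norm_coeff_le {x : unitSpace G} (g h : SrcFiber x) (a : CStarRed G) :
    ‖coeff g h a‖ ≤ ‖a‖ := by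
  calc ‖coeff g h a‖ ≤ ‖rho x a (delta h)‖ := lp.norm_apply_le_norm (by norm_num) _ g
    _ ≤ ‖rho x a‖ * ‖delta h‖ := (rho x a).le_opNorm _
    _ ≤ ‖a‖ := by rw [norm_delta, mul_one]; exact norm_rho_le x a

theorem coeff_coe {x : unitSpace G} (g h : SrcFiber x) (f : CcRed G) :
    coeff g h (f : CStarRed G) = f.toFun (mul g.1 (inv h.1)) := by
  rw [coeff, rho_coe]
  exact convVec_delta f.toFun g h

theorem continuous_coeff {x : unitSpace G} (g h : SrcFiber x) :
    Continuous (coeff g h : CStarRed G → ℂ) := by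
  refine LipschitzWith.continuous (K := 1) (LipschitzWith.of_dist_le_mul fun a b => ?_)
  rw [dist_eq_norm, dist_eq_norm, ← coeff_sub, NNReal.coe_one, one_mul]
  exact norm_coeff_le g h _

/-- On the dense subspace both sides are f at the same arrow. The fibres may differ, so entries can
be moved from one representation to another. -/
theorem coeff_congr {x y : unitSpace G} {g h : SrcFiber x} {g' h' : SrcFiber y}
    (e : mul g.1 (inv h.1) = mul g'.1 (inv h'.1)) (a : CStarRed G) :
    coeff g h a = coeff g' h' a := by
  induction a using UniformSpace.Completion.induction_on with
  | hp => exact isClosed_eq (continuous_coeff g h) (continuous_coeff g' h')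
  | ih f => rw [coeff_coe, coeff_coe, e]

theorem rho_ne_zero_iff {x : unitSpace G} {a : CStarRed G} :
    rho x a ≠ 0 ↔ ∃ g h : SrcFiber x, coeff g h a ≠ 0 := by
  constructor
  · intro h0
    by_contra hc
    push Not at hc
    exact h0 (ext_delta fun h g => hc g h)
  · rintro ⟨g, h, hgh⟩ h0
    exact hgh (by rw [coeff, h0]; rfl)

theorem rho_delta_ne_zero_iff {x : unitSpace G} {a : CStarRed G} :
    rho x a (delta (unitPt x)) ≠ 0 ↔ ∃ g : SrcFiber x, coeff g (unitPt x) a ≠ 0 := by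
  constructor
  · intro h0
    by_contra hc
    push Not at hc
    exact h0 (lp.ext (funext hc))
  · rintro ⟨g, hg⟩ h0
    exact hg (by rw [coeff, h0]; rfl)

/-- A nonzero entry at (g, h) equals the entry at (gh⁻¹, r(h)), which lies in the unit column over
r(h). -/
theorem exists_rho_delta_ne_zero {x : unitSpace G} {a : CStarRed G} (ha : rho x a ≠ 0) :
    ∃ h : G, srcMap h = x ∧ rho (rngMap h) a (delta (unitPt (rngMap h))) ≠ 0 := by
  obtain ⟨g, h, hgh⟩ := rho_ne_zero_iff.1 ha
  have e : src g.1 = src h.1 := g.2.trans h.2.symm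
  refine ⟨h.1, Subtype.ext h.2, rho_delta_ne_zero_iff.2
    ⟨⟨mul g.1 (inv h.1), src_mul_inv e⟩, ?_⟩⟩
  rwa [← coeff_congr (g := g) (h := h)]
  have hu : inv (rng h.1) = rng h.1 := inv_eq_self_of_src_eq_self (src_rng _)
  change _ = mul (mul g.1 (inv h.1)) (inv (rng h.1))
  rw [hu]
  conv_rhs => rw [← src_mul_inv e, mul_src]

theorem eq_zero_of_forall_rho_eq_zero {a : CStarRed G} (ha : ∀ x, rho x a = 0) : a = 0 := by
  by_contra hne
  have hpos : 0 < ‖a‖ := norm_pos_iff.2 hne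
  obtain ⟨_, hb, f, rfl⟩ := Metric.dense_iff.1
    (UniformSpace.Completion.denseRange_coe (α := CcRed G)) a (‖a‖ / 2) (by positivity)
  rw [Metric.mem_ball, dist_eq_norm] at hb
  have hf : ‖f‖ ≤ ‖(f : CStarRed G) - a‖ := by
    refine Real.iSup_le (fun x => ?_) (norm_nonneg _)
    have := norm_rho_le x ((f : CStarRed G) - a)
    rwa [map_sub, ha x, sub_zero, rho_coe] at this
  have h1 : ‖a‖ ≤ ‖(f : CStarRed G)‖ + ‖(f : CStarRed G) - a‖ := by
    calc ‖a‖ = ‖(f : CStarRed G) - ((f : CStarRed G) - a)‖ := by rw [sub_sub_cancel]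
      _ ≤ _ := norm_sub_le _ _
  rw [UniformSpace.Completion.norm_coe] at h1
  linarith

end coefficients

/-! ### Local sections and transport of meager sets -/

section etale

variable {G : Type*} [TopologicalSpace G] [ArrowGroupoid G] [IsEtale G]

theorem continuous_srcMap : Continuous (srcMap : G → unitSpace G) :=
  IsEtale.isLocalHomeomorph_src.continuous

theorem continuous_rngMap : Continuous (rngMap : G → unitSpace G) :=
  IsEtale.isLocalHomeomorph_rng.continuous

theorem continuousAt_mul {X : Type*} [TopologicalSpace X] {u v : X → G} {x : X}
    (hu : ContinuousAt u x) (hv : ContinuousAt v x) (h : ∀ᶠ z in 𝓝 x, src (u z) = rng (v z)) :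
    ContinuousAt (fun z => mul (u z) (v z)) x := by
  have h1 := IsEtale.continuousOn_mul (G := G) (u x, v x) h.self_of_nhds
  exact h1.tendsto.comp (tendsto_nhdsWithin_iff.2 ⟨hu.prodMk hv, h⟩)

/-- A local inverse of s at g, cut down so that its values stay in one bisection; this makes r ∘ τ
injective. -/
theorem exists_section (g : G) : ∃ (U : Set (unitSpace G)) (τ : unitSpace G → G),
    IsOpen U ∧ srcMap g ∈ U ∧ τ (srcMap g) = g ∧ ContinuousOn τ U ∧
    (∀ z ∈ U, srcMap (τ z) = z) ∧ ∀ z ∈ U, ∀ w ∈ U, rng (τ z) = rng (τ w) → z = w := by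
  obtain ⟨e, he, hes⟩ := (IsEtale.isLocalHomeomorph_src (G := G)) g
  obtain ⟨A, ⟨hA, -, hAr⟩, hgA⟩ := exists_openBisection g
  have hsymm : e.symm (srcMap g) = g := by rw [hes]; exact e.left_inv he
  have hmem : srcMap g ∈ e.target := by rw [hes]; exact e.map_source he
  have hsec : ∀ z ∈ e.target, srcMap (e.symm z) = z := fun z hz => by
    rw [hes]; exact e.right_inv hz
  refine ⟨e.target ∩ e.symm ⁻¹' A, e.symm, e.isOpen_inter_preimage_symm hA,
    ⟨hmem, ?_⟩, hsymm, e.continuousOn_symm.mono Set.inter_subset_left, fun z hz => hsec z hz.1,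
    fun z hz w hw hzw => ?_⟩
  · rwa [Set.mem_preimage, hsymm]
  · rw [← hsec z hz.1, ← hsec w hw.1, hAr hz.2 hw.2 hzw]

/-- On each bisection s is an open embedding and r is open and continuous, so pulling back along r
and pushing forward along s preserves meagerness. -/
theorem isMeagre_setOf_exists_rngMap_mem {W : ℕ → Set G} (hW : ∀ n, IsOpenBisection (W n))
    (hcover : ⋃ n, W n = Set.univ) {M : Set (unitSpace G)} (hM : IsMeagre M) :
    IsMeagre {x : unitSpace G | ∃ h : G, srcMap h = x ∧ rngMap h ∈ M} := by
  have key : ∀ n, IsMeagre ((fun h : W n => srcMap h.1) '' ((fun h : W n => rngMap h.1) ⁻¹' M)) := by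
    intro n
    have hval : IsLocalHomeomorph (Subtype.val : W n → G) :=
      (hW n).1.isOpenEmbedding_subtypeVal.isLocalHomeomorph
    have hs := (IsEtale.isLocalHomeomorph_src (G := G)).comp hval
    have hr := (IsEtale.isLocalHomeomorph_rng (G := G)).comp hval
    refine (hs.isOpenEmbedding_of_injective fun a b hab => ?_).isInducing.isMeagre_image
      (hM.preimage_of_isOpenMap hr.continuous hr.isOpenMap)
    exact Subtype.ext ((hW n).2.1 a.2 b.2 (congrArg Subtype.val hab))
  refine (isMeagre_iUnion key).mono ?_
  rintro x ⟨h, rfl, hh⟩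
  obtain ⟨n, hn⟩ := Set.mem_iUnion.1 (hcover.symm ▸ Set.mem_univ h : h ∈ ⋃ n, W n)
  exact Set.mem_iUnion.2 ⟨n, ⟨h, hn⟩, hh, rfl⟩

/-! ### Continuity along sections and the exceptional meager set -/

/-- A function in `C_c(𝒢)` is continuous along `σ` at `x₀`, once finitely many bisections that
contain arrows parallel to, but different from, `σ x₀` are avoided. -/
theorem exists_bisections_tendsto {X : Type*} [TopologicalSpace X] {f : G → ℂ} (hf : f ∈ Cc G)
    {σ : X → G} {x₀ : X} (hσ : ContinuousAt σ x₀) :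
    ∃ T : Set (Set G), T.Finite ∧
      (∀ W ∈ T, IsOpenBisection W ∧
        ∃ g ∈ W, src g = src (σ x₀) ∧ rng g = rng (σ x₀) ∧ g ≠ σ x₀) ∧
      Tendsto (fun z => f (σ z)) (𝓝 x₀ ⊓ 𝓟 {z | ∀ W ∈ T, σ z ∉ W}) (𝓝 (f (σ x₀))) := by
  classical
  induction hf using Submodule.span_induction with
  | zero => exact ⟨∅, Set.finite_empty, by simp, tendsto_const_nhds⟩
  | add f f' _ _ h h' =>
    obtain ⟨T, hT, hTW, hlim⟩ := h
    obtain ⟨T', hT', hTW', hlim'⟩ := h'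
    refine ⟨T ∪ T', hT.union hT', fun W hW => hW.elim (hTW W) (hTW' W), ?_⟩
    refine (hlim.mono_left ?_).add (hlim'.mono_left ?_)
    · exact inf_le_inf_left _ (principal_mono.2 fun z hz W hW => hz W (Or.inl hW))
    · exact inf_le_inf_left _ (principal_mono.2 fun z hz W hW => hz W (Or.inr hW))
  | smul c f _ h =>
    obtain ⟨T, hT, hTW, hlim⟩ := h
    exact ⟨T, hT, hTW, hlim.const_smul c⟩
  | mem f hf =>
    obtain ⟨V, hV, _, φ, rfl⟩ := hf
    by_cases hx : σ x₀ ∈ V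
    · refine ⟨∅, Set.finite_empty, by simp, ?_⟩
      have hc : ContinuousAt (Function.extend Subtype.val φ 0 : G → ℂ) (σ x₀) := by
        have := hV.isOpenEmbedding_subtypeVal.continuousAt_iff (x := (⟨σ x₀, hx⟩ : V))
          (g := (Function.extend Subtype.val φ 0 : G → ℂ))
        rw [← this, Function.extend_comp Subtype.val_injective]
        exact φ.continuous.continuousAt
      exact (hc.tendsto.comp hσ).mono_left inf_le_left
    -- The compact set carrying f need not be closed in 𝒢, so σ may approach it although σ x₀ lies
    -- outside V.
    · have hK : IsCompact ((Subtype.val : V → G) '' tsupport φ) :=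
        IsCompact.image φ.hasCompactSupport continuous_subtype_val
      set K := (Subtype.val : V → G) '' tsupport φ with hKdef
      have hKV : K ⊆ V := by rintro _ ⟨v, _, rfl⟩; exact v.2
      have hf0 : ∀ g, g ∉ K → Function.extend Subtype.val φ 0 g = (0 : ℂ) := by
        intro g hg
        by_cases hgV : g ∈ V
        · have := Subtype.val_injective.extend_apply φ 0 (⟨g, hgV⟩ : V)
          simp only at this
          rw [this]
          by_contra hne
          exact hg ⟨⟨g, hgV⟩, subset_tsupport _ hne, rfl⟩
        · rw [Function.extend_apply' _ _ _ (by rintro ⟨v, rfl⟩; exact hgV v.2)]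
          rfl
      choose W hW hgW using fun g : G => exists_openBisection g
      obtain ⟨t, ht⟩ := hK.elim_finite_subcover W (fun i => (hW i).1)
        fun g _ => Set.mem_iUnion.2 ⟨g, hgW g⟩
      -- Only those members of the finite cover matter that meet K in an arrow parallel to σ x₀;
      -- that arrow differs from σ x₀ because K ⊆ V.
      let S : Set G := {i | i ∈ t ∧ ∃ g ∈ W i, g ∈ K ∧ src g = src (σ x₀) ∧ rng g = rng (σ x₀)}
      refine ⟨W '' S, (t.finite_toSet.subset fun i hi => hi.1).image W, ?_, ?_⟩
      · rintro _ ⟨i, ⟨_, g, hgi, hgK, h1, h2⟩, rfl⟩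
        exact ⟨hW i, g, hgi, h1, h2, fun e => hx (e ▸ hKV hgK)⟩
      · rw [hf0 _ fun h => hx (hKV h)]
        refine tendsto_const_nhds.congr' ?_
        suffices h : ∀ᶠ z in 𝓝 x₀ ⊓ 𝓟 {z | ∀ W' ∈ W '' S, σ z ∉ W'}, σ z ∉ K from
          h.mono fun z hz => (hf0 _ hz).symm
        by_contra hfreq
        set F := 𝓝 x₀ ⊓ 𝓟 {z | ∀ W' ∈ W '' S, σ z ∉ W'} with hF
        have hne : (F ⊓ 𝓟 {z | σ z ∈ K}).NeBot := by
          refine frequently_mem_iff_neBot.1 fun h => hfreq h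
        -- If σ kept returning to K, compactness would give a cluster point k. As the unit space is
        -- Hausdorff, k is parallel to σ x₀, so it lies in one of the avoided bisections.
        obtain ⟨k, hkK, hk⟩ := hK (f := map σ (F ⊓ 𝓟 {z | σ z ∈ K})) (by
          rw [le_principal_iff, mem_map]
          exact mem_inf_of_right (mem_principal_self _))
        have hlim : map σ (F ⊓ 𝓟 {z | σ z ∈ K}) ≤ 𝓝 (σ x₀) :=
          (map_mono (inf_le_left.trans inf_le_left)).trans hσ
        have : T2Space (unitSpace G) := IsEtale.t2_unitSpace
        have hpar : ∀ p : G → unitSpace G, Continuous p → p k = p (σ x₀) := by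
          intro p hp
          have h1 : ClusterPt (p k) (𝓝 (p (σ x₀))) :=
            hk.map hp.continuousAt ((tendsto_map'_iff.2 tendsto_map).trans
              ((map_mono hlim).trans hp.continuousAt))
          exact eq_of_nhds_neBot h1
        obtain ⟨i, hit, hki⟩ : ∃ i ∈ t, k ∈ W i := by simpa using ht hkK
        have hiS : i ∈ S := ⟨hit, k, hki, hkK, congrArg Subtype.val (hpar _ continuous_srcMap),
          congrArg Subtype.val (hpar _ continuous_rngMap)⟩
        have h2 : ∃ᶠ g in map σ (F ⊓ 𝓟 {z | σ z ∈ K}), g ∈ W i :=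
          hk.frequently ((hW i).1.mem_nhds hki)
        refine h2 ?_
        rw [eventually_map]
        have h3 : ∀ᶠ z in F, ∀ W' ∈ W '' S, σ z ∉ W' :=
          mem_inf_of_right (mem_principal_self _)
        exact (h3.filter_mono inf_le_left).mono fun z hz => hz _ ⟨i, hiS, rfl⟩

/-- The boundaries in `𝒢⁽⁰⁾` of the sources of the pairwise intersections of the sets `W n`. -/
def intersectionBoundary (W : ℕ → Set G) : Set (unitSpace G) :=
  ⋃ n, ⋃ m, frontier (srcMap '' (W n ∩ W m))

theorem isMeagre_intersectionBoundary {W : ℕ → Set G} (hW : ∀ n, IsOpenBisection (W n)) :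
    IsMeagre (intersectionBoundary W) := by
  refine isMeagre_iUnion fun n => isMeagre_iUnion fun m => IsNowhereDense.isMeagre ?_
  have ho : IsOpen (srcMap '' (W n ∩ W m)) :=
    IsEtale.isLocalHomeomorph_src.isOpenMap _ ((hW n).1.inter (hW m).1)
  rw [isClosed_frontier.isNowhereDense_iff, ← frontier_compl]
  exact interior_frontier ho.isClosed_compl

/-- Choose `W n` containing σ x and `W m` containing g. If σ returned to V arbitrarily close to x,
injectivity of s on V would put σ z in both, so x would lie in the closure of s(Wₙ ∩ Wₘ). Off the
frontier x lies in that set itself, and the arrow over x in Wₙ ∩ Wₘ equals both σ x and g. -/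
theorem eventually_notMem_of_notMem_intersectionBoundary {W : ℕ → Set G}
    (hW : ∀ n, IsOpenBisection (W n)) (hcover : ⋃ n, W n = Set.univ) {x : unitSpace G}
    (hx : x ∉ intersectionBoundary W) {σ : unitSpace G → G} (hσ : ContinuousAt σ x)
    (hsrc : ∀ᶠ z in 𝓝 x, srcMap (σ z) = z) {V : Set G} (hV : IsOpenBisection V) {g : G}
    (hgV : g ∈ V) (hgx : srcMap g = x) (hne : g ≠ σ x) : ∀ᶠ z in 𝓝 x, σ z ∉ V := by
  have hc : ∀ g : G, ∃ n, g ∈ W n := fun g =>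
    Set.mem_iUnion.1 (hcover.symm ▸ Set.mem_univ g : g ∈ ⋃ n, W n)
  obtain ⟨n, hn⟩ := hc (σ x)
  obtain ⟨m, hm⟩ := hc g
  have hinj : ∀ {A : Set G}, IsOpenBisection A → ∀ {a b}, a ∈ A → b ∈ A → srcMap a = srcMap b →
      a = b := fun hA _ _ ha hb e => hA.2.1 ha hb (congrArg Subtype.val e)
  by_contra hfreq
  have h1 : ∀ᶠ z in 𝓝 x, σ z ∈ W n := hσ ((hW n).1.mem_nhds hn)
  have h2 : ∀ᶠ z in 𝓝 x, z ∈ srcMap '' (V ∩ W m) :=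
    (IsEtale.isLocalHomeomorph_src.isOpenMap _ (hV.1.inter (hW m).1)).mem_nhds
      ⟨g, ⟨hgV, hm⟩, hgx⟩
  have hcl : x ∈ closure (srcMap '' (W n ∩ W m)) := by
    rw [mem_closure_iff_frequently]
    refine ((not_eventually.1 hfreq).and_eventually (h1.and (h2.and hsrc))).mono ?_
    rintro z ⟨hzV, hzn, ⟨w, ⟨hwV, hwm⟩, hwz⟩, hz⟩
    have e : w = σ z := hinj hV hwV (not_not.1 hzV) (hwz.trans hz.symm)
    exact ⟨w, ⟨e ▸ hzn, hwm⟩, hwz⟩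
  have hin : x ∈ srcMap '' (W n ∩ W m) := by
    by_contra hnot
    exact hx (Set.mem_iUnion.2 ⟨n, Set.mem_iUnion.2
      ⟨m, hcl, fun h => hnot (interior_subset h)⟩⟩)
  obtain ⟨w, ⟨hwn, hwm⟩, hwx⟩ := hin
  refine hne ?_
  rw [← hinj (hW m) hwm hm (hwx.trans hgx.symm)]
  exact hinj (hW n) hwn hn (hwx.trans hsrc.self_of_nhds.symm)

/-- The preceding avoidance applied to the inclusion of units: off the boundary, the bisections Vₖ
miss a whole neighbourhood of x in the unit space. -/
theorem extremelyDangerous_subset_intersectionBoundary {W : ℕ → Set G}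
    (hW : ∀ n, IsOpenBisection (W n)) (hcover : ⋃ n, W n = Set.univ) :
    extremelyDangerous G ⊆ intersectionBoundary W := by
  rintro x ⟨n, g, V, U, hg, hV, hU, hxU, hint⟩
  by_contra hx
  have h1 : ∀ k, ∀ᶠ z : unitSpace G in 𝓝 x, z.1 ∉ V k := fun k =>
    eventually_notMem_of_notMem_intersectionBoundary hW hcover hx
      continuous_subtype_val.continuousAt (Eventually.of_forall fun z => Subtype.ext z.2)
      (hV k).1 (hV k).2 (Subtype.ext (hg k).1) (hg k).2.2
  have h2 : U \ ⋃ k, Subtype.val ⁻¹' V k ∈ 𝓝 x := by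
    filter_upwards [eventually_all.2 h1, hU.mem_nhds hxU] with z hz hzU
    exact ⟨hzU, by simpa using hz⟩
  exact (hint ▸ mem_interior_iff_mem_nhds.2 h2 : x ∈ (∅ : Set (unitSpace G)))

/-! ### Spreading nonvanishing to open sets -/

/-- Replaces a nonzero coefficient by a strict inequality on values of a single f. It persists where
f varies continuously, and `rho_ne_zero_of_norm_sub_lt` converts it back. -/
theorem exists_norm_sub_lt {x : unitSpace G} {a : CStarRed G} {g h : SrcFiber x}
    (ha : coeff g h a ≠ 0) :
    ∃ f : CcRed G, ‖a - (f : CStarRed G)‖ < ‖f.toFun (mul g.1 (inv h.1))‖ := by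
  have hpos : 0 < ‖coeff g h a‖ := norm_pos_iff.2 ha
  obtain ⟨_, hb, f, rfl⟩ := Metric.dense_iff.1
    (UniformSpace.Completion.denseRange_coe (α := CcRed G)) a (‖coeff g h a‖ / 2) (by positivity)
  rw [Metric.mem_ball', dist_eq_norm] at hb
  refine ⟨f, ?_⟩
  have h1 := norm_coeff_le g h (a - (f : CStarRed G))
  rw [coeff_sub, coeff_coe] at h1
  have h2 := norm_sub_norm_le (coeff g h a) (f.toFun (mul g.1 (inv h.1)))
  linarith

theorem rho_ne_zero_of_norm_sub_lt {a : CStarRed G} {f : CcRed G} {g h : G}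
    (e : src g = src h) (hf : ‖a - (f : CStarRed G)‖ < ‖f.toFun (mul g (inv h))‖) :
    rho (srcMap h) a ≠ 0 := by
  refine rho_ne_zero_iff.2 ⟨⟨g, e⟩, ⟨h, rfl⟩, fun h0 => ?_⟩
  have h1 := norm_coeff_le (x := srcMap h) ⟨g, e⟩ ⟨h, rfl⟩ (a - (f : CStarRed G))
  rw [coeff_sub, coeff_coe, h0, zero_sub, norm_neg] at h1
  exact absurd hf (not_lt.2 h1)

/-- The unit column matters: its entries sit at arrows with source x, the point assumed off the
boundary, whereas a general gh⁻¹ has source r(h). -/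
theorem eventually_rho_ne_zero {W : ℕ → Set G} (hW : ∀ n, IsOpenBisection (W n))
    (hcover : ⋃ n, W n = Set.univ) {x : unitSpace G} (hx : x ∉ intersectionBoundary W)
    {a : CStarRed G} (ha : rho x a (delta (unitPt x)) ≠ 0) : ∀ᶠ z in 𝓝 x, rho z a ≠ 0 := by
  obtain ⟨⟨g, hg⟩, hgx⟩ := rho_delta_ne_zero_iff.1 ha
  obtain ⟨f, hf⟩ := exists_norm_sub_lt hgx
  obtain rfl : srcMap g = x := Subtype.ext hg
  have hmul : ∀ {k : G} {z : unitSpace G}, srcMap k = z → mul k (inv z.1) = k := by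
    rintro k _ rfl
    exact (congrArg (mul k) (inv_eq_self_of_src_eq_self (src_src k))).trans (mul_src k)
  obtain ⟨U, τ, hU, hxU, hτg, hτ, hsec, -⟩ := exists_section g
  have hτc : ContinuousAt τ (srcMap g) := hτ.continuousAt (hU.mem_nhds hxU)
  have hsec' : ∀ᶠ z in 𝓝 (srcMap g), srcMap (τ z) = z :=
    Filter.mem_of_superset (hU.mem_nhds hxU) hsec
  obtain ⟨T, hT, hTW, hlim⟩ := exists_bisections_tendsto
    (Subtype.prop (p := fun f => f ∈ Cc G) f) hτc
  have hav : ∀ᶠ z in 𝓝 (srcMap g), ∀ V ∈ T, τ z ∉ V := by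
    refine (eventually_all_finite hT).2 fun V hV => ?_
    obtain ⟨hVb, k, hkV, hk, -, hne⟩ := hTW V hV
    refine eventually_notMem_of_notMem_intersectionBoundary hW hcover hx hτc hsec' hVb hkV ?_ hne
    rw [hτg] at hk
    exact Subtype.ext hk
  -- Avoidance holds on a neighbourhood, so the restricted limit is a full one.
  rw [inf_eq_left.2 (le_principal_iff.2 hav), hτg] at hlim
  have hf' : ‖a - (f : CStarRed G)‖ < ‖f.toFun g‖ := by
    have := hmul (k := g) rfl
    rwa [show mul g (inv (unitPt (srcMap g)).1) = g from this] at hf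
  filter_upwards [hlim.norm.eventually (lt_mem_nhds hf'), hsec'] with z hz hsz
  have hzz : srcMap z.1 = z := Subtype.ext z.2
  rw [← hzz]
  refine rho_ne_zero_of_norm_sub_lt (f := f) (g := τ z) ?_ ?_
  · exact congrArg Subtype.val (hsz.trans hzz.symm)
  · rw [hmul hsz]; exact hz

/-- The preimage of W under m ↦ τ(r(m)) m τ'(s(m))⁻¹. Injectivity of r ∘ τ and r ∘ τ' recovers the
missing endpoint of m, then cancellation recovers m. -/
theorem isOpenBisection_translate {U U' : Set (unitSpace G)} {τ τ' : unitSpace G → G}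
    (hU : IsOpen U) (hU' : IsOpen U') (hτ : ContinuousOn τ U) (hτ' : ContinuousOn τ' U')
    (hsec : ∀ z ∈ U, srcMap (τ z) = z) (hsec' : ∀ z ∈ U', srcMap (τ' z) = z)
    (hinj : ∀ z ∈ U, ∀ w ∈ U, rng (τ z) = rng (τ w) → z = w)
    (hinj' : ∀ z ∈ U', ∀ w ∈ U', rng (τ' z) = rng (τ' w) → z = w)
    {W : Set G} (hW : IsOpenBisection W) :
    IsOpenBisection {m : G | rngMap m ∈ U ∧ srcMap m ∈ U' ∧
      mul (mul (τ (rngMap m)) m) (inv (τ' (srcMap m))) ∈ W} := by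
  have hs : ∀ {m : G}, rngMap m ∈ U → src (τ (rngMap m)) = rng m := fun h =>
    congrArg Subtype.val (hsec _ h)
  have hs' : ∀ {m : G}, srcMap m ∈ U' → src (τ' (srcMap m)) = src m := fun h =>
    congrArg Subtype.val (hsec' _ h)
  have hmid : ∀ {m : G}, rngMap m ∈ U → srcMap m ∈ U' →
      src (mul (τ (rngMap m)) m) = src (τ' (srcMap m)) := fun h h' => by
    rw [src_mul _ _ (hs h), hs' h']
  have hcancel : ∀ {m m' : G}, rngMap m ∈ U → srcMap m ∈ U' → rngMap m' ∈ U → srcMap m' ∈ U' →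
      rngMap m = rngMap m' → srcMap m = srcMap m' →
      mul (mul (τ (rngMap m)) m) (inv (τ' (srcMap m))) =
        mul (mul (τ (rngMap m')) m') (inv (τ' (srcMap m'))) → m = m' := by
    intro m m' h1 h2 h1' h2' er es e
    have e1 := hmid h1 h2
    have e1' := hmid h1' h2'
    have e2 := hs h1
    have e2' := hs h1'
    rw [er] at e e1 e2
    rw [es] at e e1
    refine mul_left_cancel_of_src e2 e2' (mul_right_cancel_of_rng ?_ ?_ e)
    · rw [rng_inv, e1]
    · rw [rng_inv, e1']
  refine ⟨?_, ?_, ?_⟩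
  · rw [isOpen_iff_mem_nhds]
    rintro m ⟨h1, h2, h3⟩
    have n1 : ∀ᶠ k in 𝓝 m, rngMap k ∈ U :=
      continuous_rngMap.continuousAt (hU.mem_nhds h1)
    have n2 : ∀ᶠ k in 𝓝 m, srcMap k ∈ U' :=
      continuous_srcMap.continuousAt (hU'.mem_nhds h2)
    have c1 : ContinuousAt (fun k : G => τ (rngMap k)) m :=
      ContinuousAt.comp (f := rngMap) (hτ.continuousAt (hU.mem_nhds h1))
        continuous_rngMap.continuousAt
    have c2 : ContinuousAt (fun k : G => τ' (srcMap k)) m :=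
      ContinuousAt.comp (f := srcMap) (hτ'.continuousAt (hU'.mem_nhds h2))
        continuous_srcMap.continuousAt
    have c3 : ContinuousAt
        (fun k : G => mul (mul (τ (rngMap k)) k) (inv (τ' (srcMap k)))) m := by
      refine continuousAt_mul (continuousAt_mul c1 continuousAt_id (n1.mono fun k hk => hs hk))
        (IsEtale.continuous_inv.continuousAt.comp c2) ?_
      filter_upwards [n1, n2] with k hk hk'
      rw [rng_inv]
      exact hmid hk hk'
    filter_upwards [n1, n2, c3 (hW.1.mem_nhds h3)] with k k1 k2 k3 using ⟨k1, k2, k3⟩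
  · rintro m ⟨h1, h2, h3⟩ m' ⟨h1', h2', h3'⟩ e
    have es : srcMap m = srcMap m' := Subtype.ext e
    have ew := hW.2.1 h3 h3' (by
      rw [src_mul_inv (hmid h1 h2), src_mul_inv (hmid h1' h2'), es])
    refine hcancel h1 h2 h1' h2' (hinj _ h1 _ h1' ?_) es ew
    have := congrArg rng ew
    rwa [rng_mul_inv (hmid h1 h2), rng_mul_inv (hmid h1' h2'), rng_mul _ _ (hs h1),
      rng_mul _ _ (hs h1')] at this
  · rintro m ⟨h1, h2, h3⟩ m' ⟨h1', h2', h3'⟩ e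
    have er : rngMap m = rngMap m' := Subtype.ext e
    have ew := hW.2.2 h3 h3' (by
      rw [rng_mul_inv (hmid h1 h2), rng_mul_inv (hmid h1' h2'), rng_mul _ _ (hs h1),
        rng_mul _ _ (hs h1'), er])
    refine hcancel h1 h2 h1' h2' er (hinj' _ h2 _ h2' ?_) ew
    have := congrArg src ew
    rwa [src_mul_inv (hmid h1 h2), src_mul_inv (hmid h1' h2')] at this

/-- The entry at kh⁻¹ is followed along σ(z) = τ(z)τ'(z)⁻¹. A unit z in the chosen domain lies in a
translated bisection exactly when σ(z) lies in the original one, so y ∉ D₀ yields an open set where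
all are avoided. That set need not contain y. -/
theorem exists_isOpen_rho_ne_zero {y : unitSpace G} (hy : y ∉ extremelyDangerous G)
    {a : CStarRed G} (ha : rho y a ≠ 0) :
    ∃ O : Set (unitSpace G), IsOpen O ∧ O.Nonempty ∧ ∀ z ∈ O, rho z a ≠ 0 := by
  obtain ⟨⟨k, hk⟩, ⟨h, hh⟩, hkh⟩ := rho_ne_zero_iff.1 ha
  obtain ⟨f, hf⟩ := exists_norm_sub_lt hkh
  have hky : srcMap k = y := Subtype.ext hk
  have hhy : srcMap h = y := Subtype.ext hh
  obtain ⟨U, τ, hU, hyU, hτk, hτ, hsec, hinj⟩ := exists_section k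
  obtain ⟨U', τ', hU', hyU', hτh, hτ', hsec', hinj'⟩ := exists_section h
  rw [hky] at hyU hτk
  rw [hhy] at hyU' hτh
  have hs : ∀ z ∈ U, src (τ z) = z := fun z hz => congrArg Subtype.val (hsec z hz)
  have hs' : ∀ z ∈ U', src (τ' z) = z := fun z hz => congrArg Subtype.val (hsec' z hz)
  have hσ : ContinuousAt (fun z => mul (τ z) (inv (τ' z))) y := by
    refine continuousAt_mul (hτ.continuousAt (hU.mem_nhds hyU))
      (IsEtale.continuous_inv.continuousAt.comp (hτ'.continuousAt (hU'.mem_nhds hyU'))) ?_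
    filter_upwards [hU.mem_nhds hyU, hU'.mem_nhds hyU'] with z hz hz'
    rw [rng_inv, hs z hz, hs' z hz']
  obtain ⟨T, hT, hTW, hlim⟩ := exists_bisections_tendsto
    (Subtype.prop (p := fun f => f ∈ Cc G) f) hσ
  simp only [hτk, hτh] at hTW hlim
  have hev := hlim.norm.eventually (lt_mem_nhds hf)
  rw [eventually_inf_principal] at hev
  obtain ⟨N, hN, hNo, hyN⟩ := mem_nhds_iff.1
    (hev.and ((hU.eventually_mem hyU).and (hU'.eventually_mem hyU')))
  let B : Set G → Set G := fun W => {m : G | rngMap m ∈ U ∧ srcMap m ∈ U' ∧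
      mul (mul (τ (rngMap m)) m) (inv (τ' (srcMap m))) ∈ W}
  -- For g ∈ W parallel to kh⁻¹ the witness is k⁻¹gh, an isotropy element at y; it is trivial only
  -- if g = kh⁻¹.
  have hB : ∀ W ∈ T, ∃ m ∈ B W, src m = y.1 ∧ rng m = y.1 ∧ m ≠ y.1 := by
    intro W hW
    obtain ⟨-, g, hgW, hgs, hgr, hne⟩ := hTW W hW
    have ekh : src k = src h := hk.trans hh.symm
    rw [src_mul_inv ekh] at hgs
    rw [rng_mul_inv ekh] at hgr
    have e1 : rng k = rng (mul g h) := by rw [rng_mul _ _ hgs, hgr]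
    have e2 : src (mul (inv k) (mul g h)) = y.1 := by
      rw [src_inv_mul e1, src_mul _ _ hgs, hh]
    have e3 : rng (mul (inv k) (mul g h)) = y.1 := by rw [rng_inv_mul e1, hk]
    have e4 : srcMap (mul (inv k) (mul g h)) = y := Subtype.ext e2
    have e5 : rngMap (mul (inv k) (mul g h)) = y := Subtype.ext e3
    refine ⟨mul (inv k) (mul g h), ⟨?_, ?_, ?_⟩, e2, e3, fun e => hne ?_⟩
    · rwa [e5]
    · rwa [e4]
    · rwa [e4, e5, hτk, hτh, mul_inv_mul_mul_cancel e1, mul_mul_inv_cancel hgs]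
    · have e6 := mul_inv_mul_mul_cancel e1
      rw [e, ← hk, mul_src] at e6
      conv_rhs => rw [e6, mul_mul_inv_cancel hgs]
  obtain ⟨n, V, -, hVT⟩ := hT.fin_param
  have hV : ∀ i, V i ∈ T := fun i => hVT ▸ Set.mem_range_self i
  choose m hmB hm using fun i => hB (V i) (hV i)
  refine ⟨interior (N \ ⋃ i, Subtype.val ⁻¹' B (V i)), isOpen_interior,
    Set.nonempty_iff_ne_empty.2 fun hempty => hy ⟨n, m, fun i => B (V i), N, hm, fun i =>
      ⟨isOpenBisection_translate hU hU' hτ hτ' hsec hsec' hinj hinj' (hTW _ (hV i)).1, hmB i⟩,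
      hNo, hyN, hempty⟩, fun z hz => ?_⟩
  obtain ⟨hzN, hzB⟩ := interior_subset hz
  obtain ⟨hz1, hz2, hz3⟩ := hN hzN
  have hlt := hz1 fun W hW hzW => by
    obtain ⟨i, rfl⟩ := (hVT.symm ▸ hW : W ∈ Set.range V)
    refine hzB (Set.mem_iUnion.2 ⟨i, ?_⟩)
    change rngMap z.1 ∈ U ∧ srcMap z.1 ∈ U' ∧ _
    have r1 : rngMap z.1 = z := rngMap_unit z
    have r2 : srcMap z.1 = z := Subtype.ext z.2
    rw [r1, r2]
    refine ⟨hz2, hz3, ?_⟩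
    have : mul (τ z) z.1 = τ z := by
      conv_lhs => rw [← hs z hz2, mul_src]
    rwa [this]
  have := rho_ne_zero_of_norm_sub_lt (a := a) (f := f) (g := τ z) (h := τ' z)
    ((hs z hz2).trans (hs' z hz3).symm) hlt
  rwa [hsec' z hz3] at this

/-! ### The descriptions of the singular ideal -/

theorem singularIdeal_eq_setOf_isMeagre_rho {W : ℕ → Set G} (hW : ∀ n, IsOpenBisection (W n))
    (hcover : ⋃ n, W n = Set.univ) :
    singularIdeal G = {a : CStarRed G | IsMeagre {x : unitSpace G | rho x a ≠ 0}} := by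
  refine Set.Subset.antisymm (fun a ha => ?_) fun a ha => ?_
  · exact (isMeagre_setOf_exists_rngMap_mem hW hcover ha).mono fun x hx =>
      exists_rho_delta_ne_zero hx
  · refine IsMeagre.mono (t := {x : unitSpace G | rho x a (delta (unitPt x)) ≠ 0})
      (fun x hx (h0 : rho x a = 0) => hx ?_) ha
    rw [h0]; rfl

theorem singularIdeal_eq_iInter_ker_rho {W : ℕ → Set G} (hW : ∀ n, IsOpenBisection (W n))
    (hcover : ⋃ n, W n = Set.univ) {Y : Set (unitSpace G)} (hY : Y ⊆ (extremelyDangerous G)ᶜ)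
    (hYd : (extremelyDangerous G)ᶜ ⊆ closure Y) :
    singularIdeal G = ⋂ y ∈ Y, {a : CStarRed G | rho y a = 0} := by
  have : T2Space (unitSpace G) := IsEtale.t2_unitSpace
  have : LocallyCompactSpace (unitSpace G) := IsEtale.locallyCompact_unitSpace
  refine Set.Subset.antisymm (fun a ha => ?_) fun a ha => ?_
  · rw [singularIdeal_eq_setOf_isMeagre_rho hW hcover] at ha
    refine Set.mem_iInter₂.2 fun y hy => ?_
    by_contra hne
    obtain ⟨O, hO, hOne, hOa⟩ := exists_isOpen_rho_ne_zero (hY hy) hne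
    -- The Baire property of the locally compact Hausdorff unit space.
    exact not_isMeagre_of_isOpen hO hOne (IsMeagre.mono hOa ha)
  -- Nonvanishing at a point off the boundary would spread to a neighbourhood, which meets Y because
  -- the point lies outside D₀.
  · refine (isMeagre_intersectionBoundary hW).mono fun x hx => ?_
    by_contra hxB
    have hxY := hYd fun hxD =>
      hxB (extremelyDangerous_subset_intersectionBoundary hW hcover hxD)
    obtain ⟨y, hy, hyY⟩ := mem_closure_iff_nhds.1 hxY _ (eventually_rho_ne_zero hW hcover hxB hx)
    exact hy (Set.mem_iInter₂.1 ha y hyY)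

end etale

end ArrowGroupoid

theorem proposition1p10 (G : Type*) [TopologicalSpace G] [ArrowGroupoid G]
    [ArrowGroupoid.IsEtale G]
    (hcover : ∃ W : ℕ → Set G, (∀ n, ArrowGroupoid.IsOpenBisection (W n)) ∧
      ⋃ n, W n = Set.univ) :
    (∀ Y : Set (ArrowGroupoid.unitSpace G),
      Y ⊆ (ArrowGroupoid.extremelyDangerous G)ᶜ →
      (ArrowGroupoid.extremelyDangerous G)ᶜ ⊆ closure Y →
        ArrowGroupoid.singularIdeal G =
            {a : ArrowGroupoid.CStarRed G |
              IsMeagre {x : ArrowGroupoid.unitSpace G | ArrowGroupoid.rho x a ≠ 0}} ∧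
        ArrowGroupoid.singularIdeal G =
            ⋂ y ∈ Y, {a : ArrowGroupoid.CStarRed G | ArrowGroupoid.rho y a = 0}) ∧
    (ArrowGroupoid.extremelyDangerous G = ∅ → ArrowGroupoid.singularIdeal G = {0}) := by
  obtain ⟨W, hW, hc⟩ := hcover
  refine ⟨fun Y hY hYd => ⟨ArrowGroupoid.singularIdeal_eq_setOf_isMeagre_rho hW hc,
    ArrowGroupoid.singularIdeal_eq_iInter_ker_rho hW hc hY hYd⟩, fun hD => ?_⟩
  -- With D₀ empty, Y may be the whole unit space, and the representations `rho x` are jointly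
  -- injective.
  rw [ArrowGroupoid.singularIdeal_eq_iInter_ker_rho (Y := Set.univ) hW hc (by simp [hD]) (by simp)]
  ext a
  simp only [Set.mem_univ, Set.iInter_true, Set.mem_iInter, Set.mem_ofPred_eq,
    Set.mem_singleton_iff]
  refine ⟨ArrowGroupoid.eq_zero_of_forall_rho_eq_zero, ?_⟩
  rintro rfl x
  exact map_zero _
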